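/- Let $N\ge1$, $\omega=e^{2\pi i/N}$, and write $\mathbb{E}$ for averages. For $K\subset\mathbb{Z}_N$ and $\rho>0$ let $B(K,\rho)=\{x\in\mathbb{Z}_N: |\omega^{rx}-1|\le\rho \text{ for all } r\in K\}$. This Bohr set is called regular if for every $\epsilon>0$ with $100|K|\epsilon\le1$ one has $|B(K,\rho(1+\epsilon))|\le|B(K,\rho)|(1+100|K|\epsilon)$ and $|B(K,\rho(1-\epsilon))|\ge|B(K,\rho)|(1-100|K|\epsilon)$. A map $q:B\to\mathbb{Z}_N$ is quadratic if $q(x)-q(x+a)-q(x+b)-q(x+c)+q(x+a+b)+q(x+a+c)+q(x+b+c)-q(x+a+b+c)=0$ whenever all eight points lie in $B$; a map $\phi:B\to\mathbb{Z}_N$ is a Freiman homomorphism if $\phi(x)+\phi(y)=\phi(z)+\phi(w)$ whenever $x,y,z,w\in B$ and $x+y=z+w$. A quadratic average with base $(B,q)$, where $B$ is a regular Bohr set and $q:B\to\mathbb{Z}_N$ is quadratic, is a function $Q(x)=\mathbb{E}_{y\in x-B}\,\omega^{q(x-y)+\phi_y(x-y)}$ where each $\phi_y:B\to\mathbb{Z}_N$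 $(y\in\mathbb{Z}_N)$ is a Freiman homomorphism. A generalized quadratic average with base $(B,q)$ is a function $n^{-1}(Q_1+\dots+Q_n)$ with $n\ge1$ and each $Q_i$ a quadratic average with base $(B,q)$; it has complexity $(d,\rho)$ if $B=B(K,\rho')$ is regular with $|K|\le d$ and $\rho'\ge\rho$. For $f,g:\mathbb{Z}_N\to\mathbb{C}$ let $\|f\|_{U^2}^4=\mathbb{E}_{x,a,b}f(x)\overline{f(x+a)f(x+b)}f(x+a+b)$ and $\|g\|_{U^2}^*=\sup\{|\mathbb{E}_x g(x)\overline{h(x)}| : \|h\|_{U^2}\le1\}$. Theorem. Let $d\ge1$ be an integer, let $0<\rho\le2$, and let $Q:\mathbb{Z}_N\to\mathbb{C}$ be a generalized quadratic average of complexity $(d,\rho)$. Then for every $\alpha$ with $0<\alpha\le1/20$, either $\|Q\|_{U^2}\le(12\alpha)^{1/8}$, or there exists a function $Q'':\mathbb{Z}_N\to\mathbb{C}$ such that $\|Q-Q''\|_\infty\le16d^2\alpha$ and $\|Q''\|_{U^2}^*\le(4/\alpha)^{4d^2}(800d^2/\rho)^d$. -/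

import Mathlib

open Finset
open scoped BigOperators ENNReal ComplexConjugate

noncomputable section

namespace QuadraticAverage

variable {N : ℕ} [NeZero N]

open Classical in
/-- The Bohr set `B(K, ρ)` of all `x ∈ ℤ/Nℤ` with `|ω^(rx) - 1| ≤ ρ` for every `r ∈ K`,
where `ω = exp (2πi/N)`; `ZMod.stdAddChar t` is `ω^t`. -/
def bohrSet (K : Finset (ZMod N)) (ρ : ℝ) : Finset (ZMod N) :=
  {x | ∀ r ∈ K, ‖ZMod.stdAddChar (r * x) - 1‖ ≤ ρ}

/-- Regularity of the Bohr set `B(K, ρ)`, in the usual range `0 < ε ≤ 1 / (100 |K|)`. -/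
def IsRegularBohr (K : Finset (ZMod N)) (ρ : ℝ) : Prop :=
  ∀ ε : ℝ, 0 < ε → 100 * (#K : ℝ) * ε ≤ 1 →
    (#(bohrSet K (ρ * (1 + ε))) : ℝ) ≤ #(bohrSet K ρ) * (1 + 100 * #K * ε) ∧
    (#(bohrSet K ρ) : ℝ) * (1 - 100 * #K * ε) ≤ #(bohrSet K (ρ * (1 - ε)))

/-- `q` restricted to `A` is a quadratic map: the alternating sum of `q` over every
three-dimensional parallelepiped whose eight vertices lie in `A` vanishes. -/
def IsQuadraticOn (A : Finset (ZMod N)) (q : ZMod N → ZMod N) : Prop :=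
  ∀ x a b c : ZMod N, x ∈ A → x + a ∈ A → x + b ∈ A → x + c ∈ A →
    x + a + b ∈ A → x + a + c ∈ A → x + b + c ∈ A → x + a + b + c ∈ A →
    q x - q (x + a) - q (x + b) - q (x + c)
      + q (x + a + b) + q (x + a + c) + q (x + b + c) - q (x + a + b + c) = 0

/-- `Q` is a quadratic average with base `(B, q)`:
`Q x = 𝔼_{y ∈ x - B} ω^(q (x - y) + φ_y (x - y))` with every `φ_y` a Freiman homomorphism
on `B`. Only the values of `q` and of the `φ_y` on `B` matter. -/
def IsQuadraticAverage (B : Finset (ZMod N)) (q : ZMod N → ZMod N) (Q : ZMod N → ℂ) : Prop :=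
  ∃ φ : ZMod N → ZMod N → ZMod N,
    (∀ y, IsAddFreimanHom 2 (B : Set (ZMod N)) Set.univ (φ y)) ∧
    ∀ x, Q x = 𝔼 y ∈ B.image (fun u => x - u), ZMod.stdAddChar (q (x - y) + φ y (x - y))

/-- A generalized quadratic average with base `(B, q)` is the average of finitely many
(at least one) quadratic averages with base `(B, q)`. -/
def IsGenQuadraticAverage (B : Finset (ZMod N)) (q : ZMod N → ZMod N) (Q : ZMod N → ℂ) : Prop :=
  ∃ n : ℕ, 0 < n ∧ ∃ R : Fin n → ZMod N → ℂ,
    (∀ i, IsQuadraticAverage B q (R i)) ∧ ∀ x, Q x = (n : ℂ)⁻¹ * ∑ i, R i x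

/-- `Q` is a generalized quadratic average of complexity (at most) `(d, ρ)`: its base is
`(B, q)` with `B = B(K, ρ')` a regular Bohr set, `|K| ≤ d`, `ρ' ≥ ρ`, and `q` quadratic
on `B`. -/
def IsGenQuadraticAverageOfComplexity (d : ℕ) (ρ : ℝ) (Q : ZMod N → ℂ) : Prop :=
  ∃ (K : Finset (ZMod N)) (ρ' : ℝ) (q : ZMod N → ZMod N),
    #K ≤ d ∧ ρ ≤ ρ' ∧ IsRegularBohr K ρ' ∧ IsQuadraticOn (bohrSet K ρ') q ∧
    IsGenQuadraticAverage (bohrSet K ρ') q Q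

/-- The `U²` norm,
`‖f‖_{U²}⁴ = 𝔼_{x,a,b} f(x) conj f(x+a) conj f(x+b) f(x+a+b)` (a nonnegative real number). -/
def u2Norm (f : ZMod N → ℂ) : ℝ :=
  (𝔼 x, 𝔼 a, 𝔼 b, f x * conj (f (x + a)) * conj (f (x + b)) * f (x + a + b)).re ^ (1 / 4 : ℝ)

/-- The dual norm `‖g‖*_{U²} = sup {|⟨g, h⟩| : ‖h‖_{U²} ≤ 1}`, `⟨g, h⟩ = 𝔼_x g(x) conj h(x)`;
the supremum is taken in `[0, ∞]`. -/
def u2DualNorm (g : ZMod N → ℂ) : ℝ≥0∞ :=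
  ⨆ (h : ZMod N → ℂ) (_ : u2Norm h ≤ 1), ‖𝔼 x, g x * conj (h x)‖ₑ

end QuadraticAverage

end

/-! A large `U²` norm forces a large Fourier coefficient, because ‖f‖⁴ is an ℓ⁴ norm of the
transform. Unfolding that coefficient of Q as an average gives one phase `θ = q + φ_y - r·` that is
biased on B (`exists_bias_of_expect_quadAverage`).

A biased quadratic phase is nearly bilinearly trivial at a small scale. Shifting u by p multiplies
ω^(θ(u+a) - θ(u+a')) by the constant ω^(`mixedDiff θ a a' p`), while averages over a regular Bohr
set hardly notice the shift. So wherever the correlation in u is not small, this constant is close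
to 1. Cauchy–Schwarz supplies one a' and a dense set A of such a (`exists_mixedDiff_small`).

The mixed difference does not see Freiman homomorphisms, so the conclusion concerns q alone and
applies to every φ_y in every one of the averages. Hence the phase at u+a+p is approximately a
function of a times a function of p, for fixed u and y
(`norm_quadAverage_sub_structuredAverage_le`). Averages of such products pair with h through a
convolution, so Parseval bounds them by the `U²` norm of h
(`norm_expect_structuredAverage_mul_conj_le`). The loss is governed by the densities of A and of the
small Bohr set. -/

namespace QuadraticAverage

/-! ### Bohr sets: size and almost invariance under small shifts. -/

section BohrSets

variable {N : ℕ} [NeZero N] {K : Finset (ZMod N)} {ρ σ : ℝ} {x y : ZMod N}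

theorem mem_bohrSet : x ∈ bohrSet K ρ ↔ ∀ r ∈ K, ‖ZMod.stdAddChar (r * x) - 1‖ ≤ ρ := by
  simp [bohrSet]

theorem bohrSet_mono (h : ρ ≤ σ) : bohrSet K ρ ⊆ bohrSet K σ := fun _ hx =>
  mem_bohrSet.2 fun r hr => (mem_bohrSet.1 hx r hr).trans h

theorem zero_mem_bohrSet (h : 0 ≤ ρ) : (0 : ZMod N) ∈ bohrSet K ρ :=
  mem_bohrSet.2 fun r _ => by simpa using h

theorem norm_stdAddChar (x : ZMod N) : ‖ZMod.stdAddChar x‖ = 1 := AddChar.norm_apply _ _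

theorem stdAddChar_neg (x : ZMod N) :
    ZMod.stdAddChar (-x) = conj (ZMod.stdAddChar x) := AddChar.map_neg_eq_conj _ _

theorem stdAddChar_add (x y : ZMod N) :
    ZMod.stdAddChar (x + y) = ZMod.stdAddChar x * ZMod.stdAddChar y :=
  AddChar.map_add_eq_mul _ _ _

theorem neg_mem_bohrSet (hx : x ∈ bohrSet K ρ) : -x ∈ bohrSet K ρ :=
  mem_bohrSet.2 fun r hr => by
    have h := mem_bohrSet.1 hx r hr
    rwa [mul_neg, stdAddChar_neg, ← map_one conj, ← map_sub, RCLike.norm_conj]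

theorem add_mem_bohrSet (hx : x ∈ bohrSet K ρ) (hy : y ∈ bohrSet K σ) :
    x + y ∈ bohrSet K (ρ + σ) :=
  mem_bohrSet.2 fun r hr => by
    have h : ZMod.stdAddChar (r * (x + y)) - 1 =
        (ZMod.stdAddChar (r * x) - 1) * ZMod.stdAddChar (r * y)
          + (ZMod.stdAddChar (r * y) - 1) := by
      rw [mul_add, stdAddChar_add]; ring
    rw [h]
    refine (norm_add_le _ _).trans (add_le_add ?_ (mem_bohrSet.1 hy r hr))
    rw [norm_mul, norm_stdAddChar, mul_one]
    exact mem_bohrSet.1 hx r hr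

/-- The quotient `m * x.val / N` is the index of the arc of length 1/m that contains x/N, and two
points of one arc differ by at most N/m. -/
theorem norm_stdAddChar_sub_one_le {m : ℕ} (hm : 0 < m) {x y : ZMod N}
    (h : m * x.val / N = m * y.val / N) :
    ‖ZMod.stdAddChar (x - y) - 1‖ ≤ 2 * Real.pi / m := by
  have hN : (0 : ℝ) < N := by exact_mod_cast Nat.pos_of_ne_zero (NeZero.ne N)
  have hxy : x - y = (((x.val : ℤ) - (y.val : ℤ) : ℤ) : ZMod N) := by simp
  have hd : |(m : ℝ) * x.val - m * y.val| ≤ N := by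
    have hN' : 0 < N := Nat.pos_of_ne_zero (NeZero.ne N)
    have h1 := Nat.div_add_mod (m * x.val) N
    have h2 := Nat.div_add_mod (m * y.val) N
    have h3 := Nat.mod_lt (m * x.val) hN'
    have h4 := Nat.mod_lt (m * y.val) hN'
    rw [h] at h1
    have h5 : m * x.val ≤ m * y.val + N := by omega
    have h6 : m * y.val ≤ m * x.val + N := by omega
    rw [abs_le]
    constructor
    · have : (m : ℝ) * y.val ≤ m * x.val + N := by exact_mod_cast h6
      linarith
    · have : (m : ℝ) * x.val ≤ m * y.val + N := by exact_mod_cast h5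
      linarith
  rw [hxy, ZMod.stdAddChar_coe]
  have he : (2 * Real.pi * Complex.I * ((x.val : ℤ) - (y.val : ℤ) : ℤ) / N : ℂ)
      = Complex.I * ((2 * Real.pi * ((x.val : ℝ) - y.val) / N : ℝ) : ℂ) := by
    push_cast; ring
  rw [he]
  refine (Real.norm_exp_I_mul_ofReal_sub_one_le).trans ?_
  have hm' : (0 : ℝ) < m := by exact_mod_cast hm
  rw [Real.norm_eq_abs, abs_div, abs_mul, abs_of_pos Real.two_pi_pos, abs_of_pos hN,
    div_le_div_iff₀ hN hm', mul_assoc]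
  refine mul_le_mul_of_nonneg_left ?_ Real.two_pi_pos.le
  calc |(x.val : ℝ) - y.val| * m = |((x.val : ℝ) - y.val) * m| := by
        rw [abs_mul, abs_of_pos hm']
    _ ≤ N := by rwa [sub_mul, mul_comm _ (m : ℝ), mul_comm _ (m : ℝ)]

/-- Pigeonhole: record for each r in K the arc containing rx. Subtracting a fixed member of a fibre
maps that fibre into the Bohr set. -/
theorem card_le_pow_mul_card_bohrSet (K : Finset (ZMod N)) {m : ℕ} (hm : 0 < m)
    (hρ : 2 * Real.pi / m ≤ ρ) : N ≤ m ^ #K * #(bohrSet K ρ) := by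
  classical
  have hN : 0 < N := Nat.pos_of_ne_zero (NeZero.ne N)
  let c : ZMod N → K → Fin m := fun x r =>
    ⟨m * (r.1 * x).val / N, by
      rw [Nat.div_lt_iff_lt_mul hN]
      exact Nat.mul_lt_mul_of_pos_left (ZMod.val_lt _) hm⟩
  have hfib : ∀ t : K → Fin m, #({x | c x = t} : Finset (ZMod N)) ≤ #(bohrSet K ρ) := by
    intro t
    rcases ({x | c x = t} : Finset (ZMod N)).eq_empty_or_nonempty with h | ⟨x₀, hx₀⟩
    · simp [h]
    refine card_le_card_of_injOn (fun x => x - x₀) ?_ (fun _ _ _ _ h => sub_left_injective h)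
    intro x hx
    simp only [coe_filter, mem_univ, true_and, Set.mem_ofPred_eq, mem_filter] at hx hx₀
    refine mem_coe.2 (mem_bohrSet.2 fun r hr => ?_)
    have h : c x ⟨r, hr⟩ = c x₀ ⟨r, hr⟩ := by rw [hx, hx₀]
    rw [mul_sub]
    exact (norm_stdAddChar_sub_one_le hm (congrArg Fin.val h)).trans hρ
  calc N = #(univ : Finset (ZMod N)) := by simp
    _ = ∑ t : K → Fin m, #({x | c x = t} : Finset (ZMod N)) :=
        card_eq_sum_card_fiberwise (fun _ _ => mem_coe.2 (mem_univ _))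
    _ ≤ ∑ _t : K → Fin m, #(bohrSet K ρ) := sum_le_sum fun t _ => hfib t
    _ = m ^ #K * #(bohrSet K ρ) := by simp

/-- A Bohr set of radius `ρ ≤ 2` has density at least `(ρ / 9) ^ |K|`. -/
theorem card_le_div_pow_mul_card_bohrSet (K : Finset (ZMod N)) (hρ : 0 < ρ) (hρ2 : ρ ≤ 2) :
    (N : ℝ) ≤ (9 / ρ) ^ #K * #(bohrSet K ρ) := by
  have hpi := Real.pi_gt_three
  have hm : 0 < ⌈2 * Real.pi / ρ⌉₊ := Nat.ceil_pos.2 (by positivity)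
  have h1 : 2 * Real.pi / (⌈2 * Real.pi / ρ⌉₊ : ℝ) ≤ ρ := by
    rw [div_le_iff₀ (by exact_mod_cast hm), ← div_le_iff₀' hρ]
    exact Nat.le_ceil _
  -- Here 2π + ρ ≤ 6.3 + 2 < 9.
  have h2 : (⌈2 * Real.pi / ρ⌉₊ : ℝ) ≤ 9 / ρ := by
    refine (Nat.ceil_lt_add_one (by positivity)).le.trans ?_
    rw [div_add_one hρ.ne']
    gcongr
    linarith [Real.pi_lt_d2]
  calc (N : ℝ) ≤ (⌈2 * Real.pi / ρ⌉₊ : ℝ) ^ #K * #(bohrSet K ρ) := by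
        exact_mod_cast card_le_pow_mul_card_bohrSet K hm h1
    _ ≤ _ := by gcongr

theorem norm_expect_le_of_forall_le {ι : Type*} {s : Finset ι} {f : ι → ℂ} {c : ℝ} (hc : 0 ≤ c)
    (h : ∀ i ∈ s, ‖f i‖ ≤ c) : ‖𝔼 i ∈ s, f i‖ ≤ c := by
  rw [expect_eq_sum_div_card, norm_div, Complex.norm_natCast]
  refine div_le_of_le_mul₀ (Nat.cast_nonneg _) hc ?_
  refine (norm_sum_le_of_le s h).trans ?_
  simp [mul_comm]

theorem norm_sum_sub_sum_le {ι : Type*} [DecidableEq ι] {s t c : Finset ι} (hs : c ⊆ s)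
    (ht : c ⊆ t) {f : ι → ℂ} (hf : ∀ i, ‖f i‖ ≤ 1) :
    ‖∑ i ∈ s, f i - ∑ i ∈ t, f i‖ ≤ (#s - #c : ℝ) + (#t - #c : ℝ) := by
  rw [← sum_sdiff hs, ← sum_sdiff ht, add_sub_add_right_eq_sub]
  refine (norm_sub_le _ _).trans (add_le_add ?_ ?_)
  · refine (norm_sum_le_of_le _ fun i _ => hf i).trans ?_
    simp [card_sdiff_of_subset hs, Nat.cast_sub (card_le_card hs)]
  · refine (norm_sum_le_of_le _ fun i _ => hf i).trans ?_
    simp [card_sdiff_of_subset ht, Nat.cast_sub (card_le_card ht)]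

/-- Averages over a regular Bohr set are nearly invariant under small translations. -/
theorem IsRegularBohr.norm_expect_sub_expect_add_le (hreg : IsRegularBohr K ρ) (hρ : 0 ≤ ρ)
    {ε : ℝ} (hε : 0 < ε) (hKε : 100 * (#K : ℝ) * ε ≤ 1) {p : ZMod N}
    (hp : p ∈ bohrSet K (ρ * ε)) {f : ZMod N → ℂ} (hf : ∀ x, ‖f x‖ ≤ 1) :
    ‖𝔼 u ∈ bohrSet K ρ, f u - 𝔼 u ∈ bohrSet K ρ, f (u + p)‖ ≤ 200 * #K * ε := by
  classical
  have hB : (0 : ℝ) < #(bohrSet K ρ) := by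
    exact_mod_cast card_pos.2 ⟨0, zero_mem_bohrSet hρ⟩
  -- B and its translate B + p both contain the Bohr set of radius ρ(1 - ε), so each loses at most a
  -- proportion 100|K|ε.
  have h1 : bohrSet K (ρ * (1 - ε)) ⊆ bohrSet K ρ := bohrSet_mono (by nlinarith)
  have h2 : bohrSet K (ρ * (1 - ε)) ⊆ (bohrSet K ρ).map (addRightEmbedding p) := by
    intro x hx
    rw [mem_map]
    refine ⟨x + -p, ?_, by simp⟩
    have := add_mem_bohrSet hx (neg_mem_bohrSet hp)
    rwa [show ρ * (1 - ε) + ρ * ε = ρ by ring] at this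
  have h3 : ∑ u ∈ bohrSet K ρ, f (u + p) = ∑ u ∈ (bohrSet K ρ).map (addRightEmbedding p), f u := by
    simp [sum_map]
  rw [expect_eq_sum_div_card, expect_eq_sum_div_card, ← sub_div, norm_div, Complex.norm_natCast,
    div_le_iff₀ hB, h3]
  refine (norm_sum_sub_sum_le h1 h2 hf).trans ?_
  rw [card_map]
  have := (hreg ε hε hKε).2
  linarith

/-- If `f` and `g` are bounded by `1` and close on the inner part of a regular Bohr set, then
their averages over it are close. -/
theorem IsRegularBohr.norm_expect_sub_expect_le (hreg : IsRegularBohr K ρ) (hρ : 0 ≤ ρ)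
    {ε : ℝ} (hε : 0 < ε) (hKε : 100 * (#K : ℝ) * ε ≤ 1) {τ : ℝ} (hτ : 0 ≤ τ)
    {f g : ZMod N → ℂ} (hf : ∀ x, ‖f x‖ ≤ 1) (hg : ∀ x, ‖g x‖ ≤ 1)
    (hfg : ∀ x ∈ bohrSet K (ρ * (1 - ε)), ‖f x - g x‖ ≤ τ) :
    ‖𝔼 u ∈ bohrSet K ρ, f u - 𝔼 u ∈ bohrSet K ρ, g u‖ ≤ τ + 200 * #K * ε := by
  classical
  have hB : (0 : ℝ) < #(bohrSet K ρ) := by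
    exact_mod_cast card_pos.2 ⟨0, zero_mem_bohrSet hρ⟩
  have h1 : bohrSet K (ρ * (1 - ε)) ⊆ bohrSet K ρ := bohrSet_mono (by nlinarith)
  rw [← expect_sub_distrib, expect_eq_sum_div_card, norm_div, Complex.norm_natCast,
    div_le_iff₀ hB, ← sum_sdiff h1]
  -- On the outer shell only the trivial bound 2 is available; regularity makes the shell small.
  have h2 : ‖∑ u ∈ bohrSet K ρ \ bohrSet K (ρ * (1 - ε)), (f u - g u)‖
      ≤ (#(bohrSet K ρ) - #(bohrSet K (ρ * (1 - ε))) : ℝ) * 2 := by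
    refine (norm_sum_le_of_le _ fun u _ => (norm_sub_le _ _).trans
      (add_le_add (hf u) (hg u))).trans ?_
    rw [sum_const, card_sdiff_of_subset h1, nsmul_eq_mul, Nat.cast_sub (card_le_card h1)]
    norm_num
  have h3 : ‖∑ u ∈ bohrSet K (ρ * (1 - ε)), (f u - g u)‖ ≤ #(bohrSet K ρ) * τ := by
    refine (norm_sum_le_of_le _ hfg).trans ?_
    rw [sum_const, nsmul_eq_mul]
    gcongr
  refine (norm_add_le _ _).trans ?_
  have := (hreg ε hε hKε).2
  linarith

end BohrSets

/-! ### Fourier analysis of the `U²` norm. -/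

section Fourier

variable {N : ℕ} [NeZero N]

/-- The unnormalized Fourier transform `∑ₓ f(x) ω^(-rx)`. -/
noncomputable def fourierSum (f : ZMod N → ℂ) (r : ZMod N) : ℂ :=
  ∑ x, f x * ZMod.stdAddChar (-(r * x))

theorem sum_stdAddChar_mul (t : ZMod N) :
    ∑ r : ZMod N, ZMod.stdAddChar (r * t) = if t = 0 then (N : ℂ) else 0 := by
  have := AddChar.sum_mulShift t (ZMod.isPrimitive_stdAddChar N)
  rw [this, ZMod.card]
  split_ifs <;> simp

theorem sum_fourierSum_mul_conj (f g : ZMod N → ℂ) :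
    ∑ r, fourierSum f r * conj (fourierSum g r) = N * ∑ x, f x * conj (g x) := by
  have h : ∀ r, fourierSum f r * conj (fourierSum g r)
      = ∑ x, ∑ y, f x * conj (g y) * ZMod.stdAddChar (r * (y - x)) := by
    intro r
    rw [fourierSum, fourierSum, map_sum, sum_mul_sum]
    refine sum_congr rfl fun x _ => sum_congr rfl fun y _ => ?_
    rw [map_mul, ← stdAddChar_neg, neg_neg, mul_sub, sub_eq_neg_add, stdAddChar_add]
    ring
  simp_rw [h]
  rw [sum_comm, mul_sum]
  refine sum_congr rfl fun x _ => ?_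
  rw [sum_comm]
  simp_rw [← mul_sum, sum_stdAddChar_mul, sub_eq_zero]
  simp only [mul_ite, mul_zero, sum_ite_eq', mem_univ, if_true]
  ring

theorem sum_norm_fourierSum_sq (f : ZMod N → ℂ) :
    ∑ r, ‖fourierSum f r‖ ^ 2 = N * ∑ x, ‖f x‖ ^ 2 := by
  have h := sum_fourierSum_mul_conj f f
  simp_rw [Complex.mul_conj'] at h
  exact_mod_cast h

/-- The autocorrelation `∑ₓ f(x) conj f(x + a)`. -/
noncomputable def autocorr (f : ZMod N → ℂ) (a : ZMod N) : ℂ := ∑ x, f x * conj (f (x + a))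

theorem fourierSum_autocorr (f : ZMod N → ℂ) (r : ZMod N) :
    fourierSum (autocorr f) r = (‖fourierSum f (-r)‖ : ℂ) ^ 2 := by
  have h : ((‖fourierSum f (-r)‖ : ℂ)) ^ 2 = fourierSum f (-r) * conj (fourierSum f (-r)) :=
    (Complex.mul_conj' _).symm
  rw [h, fourierSum, fourierSum, map_sum, sum_mul_sum]
  simp_rw [autocorr, sum_mul]
  rw [sum_comm]
  refine sum_congr rfl fun x _ => ?_
  refine Fintype.sum_equiv (Equiv.addLeft x) _ _ fun a => ?_
  rw [Equiv.coe_addLeft, map_mul, ← stdAddChar_neg,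
    show -(r * a) = -(-r * x) + - -(-r * (x + a)) by ring, stdAddChar_add]
  ring

/-- Parseval for the autocorrelation, whose transform is |f̂|² up to reflection. The left side is
the unnormalized fourth power of the `U²` norm. -/
theorem sum_norm_autocorr_sq (f : ZMod N → ℂ) :
    N * ∑ a, ‖autocorr f a‖ ^ 2 = ∑ r, ‖fourierSum f r‖ ^ 4 := by
  rw [← sum_norm_fourierSum_sq, ← Equiv.sum_comp (Equiv.neg (ZMod N))]
  refine sum_congr rfl fun r _ => ?_
  rw [Equiv.neg_apply, fourierSum_autocorr, neg_neg, norm_pow, Complex.norm_real, norm_norm]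
  ring

theorem u2Norm_inner_eq (f : ZMod N → ℂ) :
    (𝔼 x, 𝔼 a, 𝔼 b, f x * conj (f (x + a)) * conj (f (x + b)) * f (x + a + b))
      = ((∑ r, ‖fourierSum f r‖ ^ 4) / N ^ 4 : ℝ) := by
  have hN : (N : ℂ) ≠ 0 := by exact_mod_cast NeZero.ne N
  have h : ∀ a, ∑ x, ∑ b, f x * conj (f (x + a)) * conj (f (x + b)) * f (x + a + b)
      = (‖autocorr f a‖ : ℂ) ^ 2 := by
    intro a
    have h' : ((‖autocorr f a‖ : ℂ)) ^ 2 = autocorr f a * conj (autocorr f a) :=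
      (Complex.mul_conj' _).symm
    rw [h', autocorr, map_sum, sum_mul_sum]
    refine sum_congr rfl fun x _ => ?_
    refine Fintype.sum_equiv (Equiv.addLeft x) _ _ fun b => ?_
    rw [Equiv.coe_addLeft, map_mul, Complex.conj_conj, add_right_comm]
    ring
  rw [expect_comm]
  simp_rw [Fintype.expect_eq_sum_div_card, ZMod.card, ← sum_div, h]
  rw [← sum_norm_autocorr_sq]
  push_cast
  field_simp

theorem u2Norm_pow_four (f : ZMod N → ℂ) :
    u2Norm f ^ 4 = (∑ r, ‖fourierSum f r‖ ^ 4) / N ^ 4 := by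
  rw [u2Norm, u2Norm_inner_eq, Complex.ofReal_re, ← Real.rpow_natCast, ← Real.rpow_mul]
  · norm_num
  · positivity

theorem u2Norm_nonneg (f : ZMod N → ℂ) : 0 ≤ u2Norm f := by
  rw [u2Norm, u2Norm_inner_eq, Complex.ofReal_re]
  positivity

theorem norm_fourierSum_le (f : ZMod N → ℂ) (r : ZMod N) :
    ‖fourierSum f r‖ ≤ N * u2Norm f := by
  have hN : (0 : ℝ) < N := by exact_mod_cast Nat.pos_of_ne_zero (NeZero.ne N)
  refine le_of_pow_le_pow_left₀ (n := 4) (by norm_num)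
    (mul_nonneg hN.le (u2Norm_nonneg f)) ?_
  rw [mul_pow, u2Norm_pow_four, mul_div_cancel₀ _ (by positivity)]
  exact single_le_sum (f := fun r => ‖fourierSum f r‖ ^ 4) (fun _ _ => by positivity)
    (mem_univ r)

/-- The inverse theorem for the `U²` norm. -/
theorem exists_u2Norm_pow_four_le (f : ZMod N → ℂ) (hf : ∀ x, ‖f x‖ ≤ 1) :
    ∃ r, u2Norm f ^ 4 ≤ ‖𝔼 x, f x * ZMod.stdAddChar (-(r * x))‖ ^ 2 := by
  have hN : (0 : ℝ) < N := by exact_mod_cast Nat.pos_of_ne_zero (NeZero.ne N)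
  obtain ⟨r, -, hr⟩ := exists_max_image univ (fun r => ‖fourierSum f r‖) univ_nonempty
  refine ⟨r, ?_⟩
  -- Two of the four factors are bounded by the largest coefficient; Parseval handles the other two.
  have h1 : ∑ s, ‖fourierSum f s‖ ^ 4 ≤ ‖fourierSum f r‖ ^ 2 * N ^ 2 := by
    calc ∑ s, ‖fourierSum f s‖ ^ 4
        ≤ ∑ s, ‖fourierSum f r‖ ^ 2 * ‖fourierSum f s‖ ^ 2 := by
          refine sum_le_sum fun s _ => ?_
          rw [show ‖fourierSum f s‖ ^ 4 = ‖fourierSum f s‖ ^ 2 * ‖fourierSum f s‖ ^ 2 by ring]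
          have := hr s (mem_univ s)
          gcongr
      _ = ‖fourierSum f r‖ ^ 2 * (N * ∑ x, ‖f x‖ ^ 2) := by
          rw [← mul_sum, sum_norm_fourierSum_sq]
      _ ≤ ‖fourierSum f r‖ ^ 2 * (N * ∑ _x : ZMod N, (1 : ℝ)) := by
          gcongr with x
          exact pow_le_one₀ (norm_nonneg _) (hf x)
      _ = _ := by rw [sum_const, card_univ, ZMod.card, nsmul_one]; ring
  rw [u2Norm_pow_four, Fintype.expect_eq_sum_div_card, ZMod.card, norm_div, Complex.norm_natCast,
    div_pow, div_le_div_iff₀ (by positivity) (by positivity)]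
  calc _ ≤ ‖fourierSum f r‖ ^ 2 * N ^ 2 * N ^ 2 := by gcongr
    _ = _ := by rw [fourierSum]; ring

/-- The double sum pairs h with the convolution of f₁ and f₂ translated by c, so Parseval applies.
-/
theorem mul_sum_mul_conj_eq (f₁ f₂ h : ZMod N → ℂ) (c : ZMod N) :
    N * ∑ a, ∑ p, f₁ a * f₂ p * conj (h (c + a + p)) =
      ∑ r, fourierSum f₁ r * fourierSum f₂ r * ZMod.stdAddChar (-(r * c))
        * conj (fourierSum h r) := by
  have hconv : ∀ r, fourierSum (fun x => ∑ a, f₁ a * f₂ (x - c - a)) r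
      = fourierSum f₁ r * fourierSum f₂ r * ZMod.stdAddChar (-(r * c)) := by
    intro r
    rw [fourierSum, fourierSum, fourierSum, sum_mul_sum, sum_mul]
    simp_rw [sum_mul]
    rw [sum_comm]
    refine sum_congr rfl fun a _ => ?_
    refine Fintype.sum_equiv (Equiv.subRight (c + a)) _ _ fun x => ?_
    rw [Equiv.subRight_apply, sub_sub,
      show -(r * x) = -(r * a) + -(r * (x - (c + a))) + -(r * c) by ring, stdAddChar_add,
      stdAddChar_add]
    ring
  simp_rw [← hconv, sum_fourierSum_mul_conj, sum_mul]
  rw [sum_comm (f := fun x a => f₁ a * f₂ (x - c - a) * conj (h x))]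
  refine congrArg _ (sum_congr rfl fun a _ => ?_)
  refine Fintype.sum_equiv (Equiv.addLeft (c + a)) _ _ fun p => ?_
  simp [add_assoc]

/-- Each coefficient of h is at most N times its `U²` norm; Cauchy–Schwarz and Parseval handle the
two remaining factors. This is what gives product functions a small dual norm. -/
theorem norm_sum_sum_mul_conj_le (A P : Finset (ZMod N)) {f₁ f₂ : ZMod N → ℂ}
    (h₁ : ∀ x, ‖f₁ x‖ ≤ 1) (h₂ : ∀ x, ‖f₂ x‖ ≤ 1) (h : ZMod N → ℂ) (c : ZMod N) :
    ‖∑ a ∈ A, ∑ p ∈ P, f₁ a * f₂ p * conj (h (c + a + p))‖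
      ≤ N * √(#A) * √(#P) * u2Norm h := by
  classical
  have hN : (0 : ℝ) < N := by exact_mod_cast Nat.pos_of_ne_zero (NeZero.ne N)
  let g₁ : ZMod N → ℂ := fun x => if x ∈ A then f₁ x else 0
  let g₂ : ZMod N → ℂ := fun x => if x ∈ P then f₂ x else 0
  have hL2 : ∀ (S : Finset (ZMod N)) (f : ZMod N → ℂ), (∀ x, ‖f x‖ ≤ 1) →
      √(∑ r, ‖fourierSum (fun x => if x ∈ S then f x else 0) r‖ ^ 2) ≤ √N * √(#S) := by
    intro S f hf
    rw [← Real.sqrt_mul hN.le, sum_norm_fourierSum_sq]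
    refine Real.sqrt_le_sqrt (mul_le_mul_of_nonneg_left ?_ hN.le)
    calc ∑ x, ‖if x ∈ S then f x else 0‖ ^ 2 ≤ ∑ x, if x ∈ S then (1 : ℝ) else 0 := by
          refine sum_le_sum fun x _ => ?_
          split_ifs
          · exact pow_le_one₀ (norm_nonneg _) (hf x)
          · simp
      _ = #S := by simp
  have hsum : ∑ a ∈ A, ∑ p ∈ P, f₁ a * f₂ p * conj (h (c + a + p))
      = ∑ a, ∑ p, g₁ a * g₂ p * conj (h (c + a + p)) := by
    simp only [g₁, g₂, ite_mul, zero_mul, mul_ite, mul_zero]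
    simp [sum_ite_mem]
  have key : N * ‖∑ a, ∑ p, g₁ a * g₂ p * conj (h (c + a + p))‖
      ≤ N * (N * √(#A) * √(#P) * u2Norm h) := by
    rw [← Complex.norm_natCast, ← norm_mul, mul_sum_mul_conj_eq, Complex.norm_natCast]
    calc _ ≤ ∑ r, ‖fourierSum g₁ r‖ * ‖fourierSum g₂ r‖ * (N * u2Norm h) := by
          refine norm_sum_le_of_le _ fun r _ => ?_
          rw [norm_mul, norm_mul, norm_mul, norm_stdAddChar, mul_one, RCLike.norm_conj]
          have := norm_fourierSum_le h r
          gcongr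
      _ = (∑ r, ‖fourierSum g₁ r‖ * ‖fourierSum g₂ r‖) * (N * u2Norm h) := by rw [sum_mul]
      _ ≤ ((√N * √(#A)) * (√N * √(#P))) * (N * u2Norm h) := by
          have := u2Norm_nonneg h
          refine mul_le_mul_of_nonneg_right ?_ (by positivity)
          refine (Real.sum_mul_le_sqrt_mul_sqrt _ _ _).trans ?_
          exact mul_le_mul (hL2 A f₁ h₁) (hL2 P f₂ h₂) (by positivity) (by positivity)
      _ = (√N * √N) * (N * √(#A) * √(#P) * u2Norm h) := by ring
      _ = _ := by rw [Real.mul_self_sqrt hN.le]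
  rw [hsum]
  exact le_of_mul_le_mul_left key hN

end Fourier

/-! ### Biased quadratic phases have small mixed differences. -/

section Bias

variable {N : ℕ} {A : Finset (ZMod N)} {q φ : ZMod N → ZMod N}

/-- The mixed second difference of `q` in the directions `a - a'` and `p`. -/
def mixedDiff (q : ZMod N → ZMod N) (a a' p : ZMod N) : ZMod N :=
  q (a + p) - q (a' + p) - q a + q a'

/-- The alternating sum over a cube splits into two parallel faces, and a Freiman homomorphism
vanishes on each. -/
theorem IsQuadraticOn.add_freimanHom (hq : IsQuadraticOn A q)
    (hφ : IsAddFreimanHom 2 (A : Set (ZMod N)) Set.univ φ) (r : ZMod N) :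
    IsQuadraticOn A (fun x => q x + φ x - r * x) := by
  intro x a b c h1 h2 h3 h4 h5 h6 h7 h8
  have e1 := hφ.add_eq_add h1 h5 h2 h3 (by ring)
  have e2 := hφ.add_eq_add h4 h8 h6 h7 (by ring)
  linear_combination hq x a b c h1 h2 h3 h4 h5 h6 h7 h8 + e1 - e2

/-- This carries information about a single biased phase over to all the φ_y. -/
theorem mixedDiff_add_freimanHom (hφ : IsAddFreimanHom 2 (A : Set (ZMod N)) Set.univ φ)
    (r : ZMod N) {a a' p : ZMod N} (ha : a ∈ A) (ha' : a' ∈ A) (hap : a + p ∈ A)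
    (hap' : a' + p ∈ A) :
    mixedDiff (fun x => q x + φ x - r * x) a a' p = mixedDiff q a a' p := by
  have e := hφ.add_eq_add hap ha' hap' ha (by ring)
  simp only [mixedDiff]
  linear_combination e

/-- The quadratic identity for the cube at a' with directions a - a', p and u: the mixed difference
at base u equals the one at base 0. -/
theorem IsQuadraticOn.apply_add_add (hq : IsQuadraticOn A q) {a a' p u : ZMod N}
    (h1 : a' ∈ A) (h2 : a ∈ A) (h3 : a' + p ∈ A) (h4 : u + a' ∈ A) (h5 : a + p ∈ A)
    (h6 : u + a ∈ A) (h7 : u + a' + p ∈ A) (h8 : u + a + p ∈ A) :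
    q (u + a + p) = q (u + a' + p) + q (u + a) - q (u + a') + mixedDiff q a a' p := by
  have e1 : a' + (a - a') = a := by ring
  have e2 : a' + u = u + a' := by ring
  have e3 : a + u = u + a := by ring
  have e4 : a' + p + u = u + a' + p := by ring
  have e5 : a + p + u = u + a + p := by ring
  have h := hq a' (a - a') p u
  rw [e1, e2, e3, e4, e5] at h
  have h := h h1 h2 h3 h4 h5 h6 h7 h8
  rw [mixedDiff]
  linear_combination -h

theorem exists_norm_expect_le {ι : Type*} {s : Finset ι} (hs : s.Nonempty) (f : ι → ℂ) :
    ∃ i ∈ s, ‖𝔼 j ∈ s, f j‖ ≤ ‖f i‖ := by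
  obtain ⟨i, hi, h⟩ := exists_max_image s (fun i => ‖f i‖) hs
  exact ⟨i, hi, norm_expect_le_of_forall_le (norm_nonneg _) h⟩

theorem norm_expect_sq_le {ι : Type*} (s : Finset ι) (f : ι → ℂ) :
    ‖𝔼 i ∈ s, f i‖ ^ 2 ≤ ‖𝔼 i ∈ s, f i * conj (f i)‖ := by
  rcases s.eq_empty_or_nonempty with rfl | hs
  · simp
  have hs' : (0 : ℝ) < #s := by exact_mod_cast card_pos.2 hs
  have h : ∑ i ∈ s, f i * conj (f i) = ((∑ i ∈ s, ‖f i‖ ^ 2 : ℝ) : ℂ) := by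
    simp_rw [Complex.mul_conj']
    push_cast
    rfl
  rw [expect_eq_sum_div_card, expect_eq_sum_div_card, h, norm_div, norm_div, Complex.norm_natCast,
    Complex.norm_real, Real.norm_of_nonneg (by positivity), div_pow,
    div_le_div_iff₀ (by positivity) hs']
  have h1 : ‖∑ i ∈ s, f i‖ ^ 2 ≤ #s * ∑ i ∈ s, ‖f i‖ ^ 2 :=
    (pow_le_pow_left₀ (norm_nonneg _) (norm_sum_le _ _) 2).trans sq_sum_le_card_mul_sum_sq
  nlinarith

/-- Terms of size below c/2 contribute at most c/2 to the average; the others contribute at most 1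
each. -/
theorem card_filter_ge_of_le_norm_expect {ι : Type*} {s : Finset ι} (hs : s.Nonempty)
    {f : ι → ℂ} (hf : ∀ i, ‖f i‖ ≤ 1) {c : ℝ} (h : c ≤ ‖𝔼 i ∈ s, f i‖) (hc : 0 ≤ c) :
    c / 2 * #s ≤ #{i ∈ s | c / 2 ≤ ‖f i‖} := by
  have hs' : (0 : ℝ) < #s := by exact_mod_cast card_pos.2 hs
  rw [expect_eq_sum_div_card, norm_div, Complex.norm_natCast, le_div_iff₀ hs'] at h
  have h1 : ‖∑ i ∈ s, f i‖ ≤ ∑ i ∈ s, (c / 2 + if c / 2 ≤ ‖f i‖ then 1 else 0) := by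
    refine norm_sum_le_of_le _ fun i _ => ?_
    split_ifs with h
    · linarith [hf i]
    · linarith
  rw [sum_add_distrib, sum_const, nsmul_eq_mul, sum_boole] at h1
  linarith

variable [NeZero N] {K : Finset (ZMod N)} {ρ : ℝ}

/-- The constant 600 is 200 for the shift by p plus 400 for discarding a shell of relative width 2κ,
which keeps u + a + p inside the Bohr set. -/
theorem IsRegularBohr.exists_mixedDiff_small (hreg : IsRegularBohr K ρ) (hρ : 0 ≤ ρ)
    {θ : ZMod N → ZMod N} (hθ : IsQuadraticOn (bohrSet K ρ) θ) {κ : ℝ} (hκ : 0 < κ)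
    (hκ1 : 2 * κ ≤ 1) (hKκ : 100 * (#K : ℝ) * (2 * κ) ≤ 1) {t : ℝ} (ht : 0 ≤ t)
    (hbias : t + 200 * #K * κ ≤ ‖𝔼 u ∈ bohrSet K ρ, ZMod.stdAddChar (θ u)‖) :
    ∃ a' ∈ bohrSet K (ρ * κ), ∃ A ⊆ bohrSet K (ρ * κ),
      t ^ 2 / 2 * #(bohrSet K (ρ * κ)) ≤ #A ∧
      ∀ a ∈ A, ∀ p ∈ bohrSet K (ρ * κ),
        ‖ZMod.stdAddChar (mixedDiff θ a a' p) - 1‖ * (t ^ 2 / 2) ≤ 600 * #K * κ := by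
  classical
  have hB : (bohrSet K ρ).Nonempty := ⟨0, zero_mem_bohrSet hρ⟩
  have hB' : (bohrSet K (ρ * κ)).Nonempty := ⟨0, zero_mem_bohrSet (by positivity)⟩
  have hKκ' : 100 * (#K : ℝ) * κ ≤ 1 := by
    have : 0 ≤ 100 * (#K : ℝ) * κ := by positivity
    linarith
  set f : ZMod N → ℂ := fun u => ZMod.stdAddChar (θ u) with hf
  have hf1 : ∀ u, ‖f u‖ ≤ 1 := fun u => (norm_stdAddChar _).le
  let G : ZMod N → ZMod N → ℂ := fun a a' => 𝔼 u ∈ bohrSet K ρ, f (u + a) * conj (f (u + a'))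
  have hg1 : ∀ a a' u, ‖f (u + a) * conj (f (u + a'))‖ ≤ 1 := by
    intro a a' u
    simp [f]
  have hG1 : ∀ a a', ‖G a a'‖ ≤ 1 := fun a a' =>
    norm_expect_le_of_forall_le zero_le_one fun u _ => hg1 a a' u
  -- Averaging over small shifts a costs at most 200|K|κ and creates the variable to be duplicated.
  have h1 : t ≤ ‖𝔼 u ∈ bohrSet K ρ, 𝔼 a ∈ bohrSet K (ρ * κ), f (u + a)‖ := by
    have h : ‖𝔼 a ∈ bohrSet K (ρ * κ), (𝔼 u ∈ bohrSet K ρ, f u - 𝔼 u ∈ bohrSet K ρ, f (u + a))‖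
        ≤ 200 * #K * κ :=
      norm_expect_le_of_forall_le (by positivity) fun a ha =>
        hreg.norm_expect_sub_expect_add_le hρ hκ hKκ' ha hf1
    rw [expect_sub_distrib, expect_const hB', expect_comm] at h
    have := norm_sub_norm_le (𝔼 u ∈ bohrSet K ρ, f u)
      (𝔼 u ∈ bohrSet K ρ, 𝔼 a ∈ bohrSet K (ρ * κ), f (u + a))
    linarith
  -- Cauchy–Schwarz in u; opening the square produces the pair a, a'.
  have h2 : t ^ 2 ≤ ‖𝔼 a' ∈ bohrSet K (ρ * κ), 𝔼 a ∈ bohrSet K (ρ * κ), G a a'‖ := by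
    refine (pow_le_pow_left₀ ht h1 2).trans ((norm_expect_sq_le _ _).trans_eq ?_)
    congr 1
    simp_rw [map_expect, expect_mul_expect]
    rw [expect_comm]
    simp_rw [G]
    rw [expect_comm (bohrSet K (ρ * κ)) (bohrSet K (ρ * κ))]
    exact expect_congr rfl fun a _ => expect_comm _ _ _
  obtain ⟨a', ha', h3⟩ := exists_norm_expect_le hB' fun a' => 𝔼 a ∈ bohrSet K (ρ * κ), G a a'
  refine ⟨a', ha', {a ∈ bohrSet K (ρ * κ) | t ^ 2 / 2 ≤ ‖G a a'‖}, filter_subset _ _,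
    card_filter_ge_of_le_norm_expect hB' (fun a => hG1 a a') (h2.trans h3) (by positivity), ?_⟩
  intro a ha p hp
  rw [mem_filter] at ha
  obtain ⟨ha, haG⟩ := ha
  set b := ZMod.stdAddChar (mixedDiff θ a a' p) with hb
  have hb1 : ‖b‖ = 1 := norm_stdAddChar _
  have hs := hreg.norm_expect_sub_expect_add_le hρ hκ hKκ' hp (hg1 a a')
  have hmem : ∀ {v : ZMod N} {c : ℝ}, c ≤ 1 → v ∈ bohrSet K (ρ * c) → v ∈ bohrSet K ρ :=
    fun hc hv => bohrSet_mono (mul_le_of_le_one_right hρ hc) hv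
  have hadd : ∀ {v w : ZMod N} {c d : ℝ}, v ∈ bohrSet K (ρ * c) → w ∈ bohrSet K (ρ * d) →
      v + w ∈ bohrSet K (ρ * (c + d)) := fun hv hw => mul_add ρ _ _ ▸ add_mem_bohrSet hv hw
  have hc := hreg.norm_expect_sub_expect_le hρ (by positivity : 0 < 2 * κ) hKκ le_rfl
    (f := fun u => f (u + p + a) * conj (f (u + p + a')))
    (g := fun u => b * (f (u + a) * conj (f (u + a'))))
    (fun u => hg1 a a' (u + p)) (fun u => by rw [norm_mul, hb1, one_mul]; exact hg1 a a' u)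
    (fun u hu => by
      have e := hθ.apply_add_add (hmem (by linarith) ha') (hmem (by linarith) ha)
        (hmem (by linarith) (hadd ha' hp)) (hmem (by linarith) (hadd hu ha'))
        (hmem (by linarith) (hadd ha hp)) (hmem (by linarith) (hadd hu ha))
        (hmem (by linarith) (hadd (hadd hu ha') hp)) (hmem (by linarith) (hadd (hadd hu ha) hp))
      have e' : θ (u + p + a) + -θ (u + p + a') = mixedDiff θ a a' p + (θ (u + a) + -θ (u + a')) := by
        rw [add_right_comm u p a, add_right_comm u p a', e]
        ring
      rw [hb]
      simp only [f]
      rw [← stdAddChar_neg, ← stdAddChar_neg, ← stdAddChar_add, ← stdAddChar_add,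
        ← stdAddChar_add, e', sub_self, norm_zero])
  rw [← mul_expect, zero_add] at hc
  change ‖G a a' - _‖ ≤ _ at hs
  change ‖_ - b * G a a'‖ ≤ _ at hc
  -- Shifting u by p both barely changes `G a a'` and nearly multiplies it by b.
  have h4 : ‖(b - 1) * G a a'‖ ≤ 600 * #K * κ := by
    have := norm_sub_le_norm_sub_add_norm_sub (b * G a a')
      (𝔼 u ∈ bohrSet K ρ, f (u + p + a) * conj (f (u + p + a'))) (G a a')
    rw [norm_sub_rev] at hc hs
    rw [sub_mul, one_mul]
    linarith
  rw [norm_mul] at h4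
  exact (mul_le_mul_of_nonneg_left haG (norm_nonneg _)).trans h4

end Bias

/-! ### Structured approximation of quadratic averages and its dual norm. -/

section Structure

variable {N : ℕ} [NeZero N] {K A B P : Finset (ZMod N)} {ρ : ℝ} {q : ZMod N → ZMod N}
  {φ : ZMod N → ZMod N → ZMod N}

/-- The value at `x` of the quadratic average with base `(B, q)` and homomorphisms `φ`. -/
noncomputable def quadAverage (B : Finset (ZMod N)) (q : ZMod N → ZMod N)
    (φ : ZMod N → ZMod N → ZMod N) (x : ZMod N) : ℂ :=
  𝔼 u ∈ B, ZMod.stdAddChar (q u + φ (x - u) u)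

theorem expect_image_sub_eq_quadAverage (x : ZMod N) :
    𝔼 y ∈ B.image (fun u => x - u), ZMod.stdAddChar (q (x - y) + φ y (x - y))
      = quadAverage B q φ x := by
  rw [expect_image sub_right_injective.injOn, quadAverage]
  simp

/-- The product of the phases `q + φ_y` at three vertices of a parallelogram, which replaces the
phase at the fourth. -/
noncomputable def parallelogramPhase (q : ZMod N → ZMod N) (φ : ZMod N → ZMod N → ZMod N)
    (a' u a p y : ZMod N) : ℂ :=
  ZMod.stdAddChar (q (u + a) + φ y (u + a)) *
    ZMod.stdAddChar (q (u + a' + p) + φ y (u + a' + p)) *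
    conj (ZMod.stdAddChar (q (u + a') + φ y (u + a')))

/-- The structured approximation to `quadAverage B q φ`. -/
noncomputable def structuredAverage (B A P : Finset (ZMod N)) (a' : ZMod N)
    (q : ZMod N → ZMod N) (φ : ZMod N → ZMod N → ZMod N) (x : ZMod N) : ℂ :=
  𝔼 u ∈ B, 𝔼 a ∈ A, 𝔼 p ∈ P, parallelogramPhase q φ a' u a p (x - u - a - p)

theorem norm_quadAverage_le (B : Finset (ZMod N)) (q : ZMod N → ZMod N)
    (φ : ZMod N → ZMod N → ZMod N) (x : ZMod N) : ‖quadAverage B q φ x‖ ≤ 1 :=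
  norm_expect_le_of_forall_le zero_le_one fun _ _ => (norm_stdAddChar _).le

theorem norm_parallelogramPhase (a' u a p y : ZMod N) :
    ‖parallelogramPhase q φ a' u a p y‖ = 1 := by
  simp [parallelogramPhase]

/-- Replacing u by u + a + p costs 400|K|κ, the shell where the cube may leave B costs another
400|K|κ, and the mixed-difference phase costs τ. -/
theorem IsRegularBohr.norm_quadAverage_sub_structuredAverage_le (hreg : IsRegularBohr K ρ)
    (hρ : 0 ≤ ρ) (hq : IsQuadraticOn (bohrSet K ρ) q)
    (hφ : ∀ y, IsAddFreimanHom 2 (bohrSet K ρ : Set (ZMod N)) Set.univ (φ y)) {κ : ℝ}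
    (hκ : 0 < κ) (hκ1 : 2 * κ ≤ 1) (hKκ : 100 * (#K : ℝ) * (2 * κ) ≤ 1) {a' : ZMod N}
    (ha' : a' ∈ bohrSet K (ρ * κ)) (hA : A ⊆ bohrSet K (ρ * κ)) (hA0 : A.Nonempty) {τ : ℝ}
    (hτ : 0 ≤ τ) (hmd : ∀ a ∈ A, ∀ p ∈ bohrSet K (ρ * κ),
      ‖ZMod.stdAddChar (mixedDiff q a a' p) - 1‖ ≤ τ) (x : ZMod N) :
    ‖quadAverage (bohrSet K ρ) q φ x
      - structuredAverage (bohrSet K ρ) A (bohrSet K (ρ * κ)) a' q φ x‖ ≤ τ + 800 * #K * κ := by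
  have hP : (bohrSet K (ρ * κ)).Nonempty := ⟨0, zero_mem_bohrSet (by positivity)⟩
  have hmem : ∀ {v : ZMod N} {c : ℝ}, c ≤ 1 → v ∈ bohrSet K (ρ * c) → v ∈ bohrSet K ρ :=
    fun hc hv => bohrSet_mono (mul_le_of_le_one_right hρ hc) hv
  have hadd : ∀ {v w : ZMod N} {c d : ℝ}, v ∈ bohrSet K (ρ * c) → w ∈ bohrSet K (ρ * d) →
      v + w ∈ bohrSet K (ρ * (c + d)) := fun hv hw => mul_add ρ _ _ ▸ add_mem_bohrSet hv hw
  have h : quadAverage (bohrSet K ρ) q φ x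
      - structuredAverage (bohrSet K ρ) A (bohrSet K (ρ * κ)) a' q φ x
      = 𝔼 a ∈ A, 𝔼 p ∈ bohrSet K (ρ * κ), (quadAverage (bohrSet K ρ) q φ x
        - 𝔼 u ∈ bohrSet K ρ, parallelogramPhase q φ a' u a p (x - u - a - p)) := by
    simp_rw [expect_sub_distrib, expect_const hP, expect_const hA0, structuredAverage]
    rw [expect_comm]
    exact congrArg _ (expect_congr rfl fun a _ => expect_comm _ _ _)
  rw [h]
  refine norm_expect_le_of_forall_le (by positivity) fun a ha =>
    norm_expect_le_of_forall_le (by positivity) fun p hp => ?_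
  have ha1 := hA ha
  have h1 := hreg.norm_expect_sub_expect_add_le hρ (by positivity : 0 < 2 * κ) hKκ
    (p := a + p) (two_mul κ ▸ hadd ha1 hp)
    (f := fun u => ZMod.stdAddChar (q u + φ (x - u) u)) fun u => (norm_stdAddChar _).le
  have h2 := hreg.norm_expect_sub_expect_le hρ (by positivity : 0 < 2 * κ) hKκ hτ
    (f := fun u => ZMod.stdAddChar (q (u + (a + p)) + φ (x - (u + (a + p))) (u + (a + p))))
    (g := fun u => parallelogramPhase q φ a' u a p (x - u - a - p))
    (fun u => (norm_stdAddChar _).le) (fun u => (norm_parallelogramPhase _ _ _ _ _).le)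
    (fun u hu => by
      -- The index y = x - u - a - p is common to all vertices of the parallelogram, so a single
      -- homomorphism φ_y is involved.
      have hy : x - (u + (a + p)) = x - u - a - p := by ring
      rw [hy]
      set y := x - u - a - p
      have e := (hq.add_freimanHom (hφ y) 0).apply_add_add (hmem (by linarith) ha')
        (hmem (by linarith) ha1)
        (hmem (by linarith) (hadd ha' hp)) (hmem (by linarith) (hadd hu ha'))
        (hmem (by linarith) (hadd ha1 hp)) (hmem (by linarith) (hadd hu ha1))
        (hmem (by linarith) (hadd (hadd hu ha') hp)) (hmem (by linarith) (hadd (hadd hu ha1) hp))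
      rw [mixedDiff_add_freimanHom (hφ y) 0 (hmem (by linarith) ha1) (hmem (by linarith) ha')
        (hmem (by linarith) (hadd ha1 hp)) (hmem (by linarith) (hadd ha' hp))] at e
      simp only [zero_mul, sub_zero] at e
      have e' : ZMod.stdAddChar (q (u + (a + p)) + φ y (u + (a + p)))
          = parallelogramPhase q φ a' u a p y * ZMod.stdAddChar (mixedDiff q a a' p) := by
        rw [parallelogramPhase, ← stdAddChar_neg, ← stdAddChar_add, ← stdAddChar_add,
          ← stdAddChar_add, ← add_assoc, e]
        congr 1
        ring
      rw [e', ← mul_sub_one, norm_mul, norm_parallelogramPhase, one_mul]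
      exact hmd a ha p hp)
  rw [quadAverage]
  refine (norm_sub_le_norm_sub_add_norm_sub _ _ _).trans ((add_le_add h1 h2).trans ?_)
  linarith

/-- With y in place of x as the variable, and u and y fixed, the phase is a function of a times a
function of p. -/
theorem norm_expect_structuredAverage_mul_conj_le (hA : A.Nonempty) (hP : P.Nonempty)
    (a' : ZMod N) (h : ZMod N → ℂ) :
    ‖𝔼 x, structuredAverage B A P a' q φ x * conj (h x)‖
      ≤ N / (√(#A) * √(#P)) * u2Norm h := by
  have hN : (0 : ℝ) < N := by exact_mod_cast Nat.pos_of_ne_zero (NeZero.ne N)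
  have hA' : (0 : ℝ) < #A := by exact_mod_cast card_pos.2 hA
  have hP' : (0 : ℝ) < #P := by exact_mod_cast card_pos.2 hP
  have hu := u2Norm_nonneg h
  have e : 𝔼 x, structuredAverage B A P a' q φ x * conj (h x)
      = 𝔼 u ∈ B, 𝔼 y, 𝔼 a ∈ A, 𝔼 p ∈ P,
          parallelogramPhase q φ a' u a p y * conj (h (y + u + a + p)) := by
    simp_rw [structuredAverage, expect_mul]
    rw [expect_comm]
    refine expect_congr rfl fun u _ => ?_
    rw [expect_comm, expect_comm (univ : Finset (ZMod N)) A]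
    refine expect_congr rfl fun a _ => ?_
    rw [expect_comm, expect_comm (univ : Finset (ZMod N)) P]
    refine expect_congr rfl fun p _ => ?_
    refine Fintype.expect_equiv (Equiv.subRight (u + a + p)) _ _ fun x => ?_
    rw [Equiv.subRight_apply]
    rw [show x - u - a - p = x - (u + a + p) by ring,
      show x - (u + a + p) + u + a + p = x by ring]
  rw [e]
  refine norm_expect_le_of_forall_le (by positivity) fun u _ =>
    norm_expect_le_of_forall_le (by positivity) fun y _ => ?_
  have hbox := norm_sum_sum_mul_conj_le A P
    (f₁ := fun a => ZMod.stdAddChar (q (u + a) + φ y (u + a)))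
    (f₂ := fun p => ZMod.stdAddChar (q (u + a' + p) + φ y (u + a' + p)) *
      conj (ZMod.stdAddChar (q (u + a') + φ y (u + a'))))
    (fun _ => (norm_stdAddChar _).le) (fun _ => by simp) h (y + u)
  simp_rw [expect_eq_sum_div_card, ← sum_div]
  rw [div_div, norm_div, ← Nat.cast_mul, Complex.norm_natCast, Nat.cast_mul,
    div_le_iff₀ (by positivity)]
  refine (le_of_eq ?_).trans (hbox.trans_eq ?_)
  · simp_rw [parallelogramPhase, mul_assoc]
  · rw [div_mul_eq_mul_div, div_mul_eq_mul_div, eq_div_iff (by positivity)]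
    linear_combination N * u2Norm h * √(#P) * √(#P) * Real.mul_self_sqrt hA'.le
      + N * u2Norm h * #A * Real.mul_self_sqrt hP'.le

/-- A Fourier coefficient of the average is itself an average, over i and y, of unimodular multiples
of these biases; some term is at least as large as the mean. -/
theorem exists_bias_of_expect_quadAverage {n : ℕ} (hn : 0 < n)
    {φ : Fin n → ZMod N → ZMod N → ZMod N} :
    ∃ i y r, u2Norm (fun x => 𝔼 i, quadAverage B q (φ i) x) ^ 4 ≤
      ‖𝔼 u ∈ B, ZMod.stdAddChar (q u + φ i y u - r * u)‖ ^ 2 := by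
  have : NeZero n := ⟨hn.ne'⟩
  obtain ⟨r, hr⟩ := exists_u2Norm_pow_four_le (fun x => 𝔼 i, quadAverage B q (φ i) x) fun x =>
    norm_expect_le_of_forall_le zero_le_one fun i _ => norm_quadAverage_le _ _ _ _
  have e : 𝔼 x, (𝔼 i, quadAverage B q (φ i) x) * ZMod.stdAddChar (-(r * x))
      = 𝔼 i, 𝔼 y, ZMod.stdAddChar (-(r * y)) *
          𝔼 u ∈ B, ZMod.stdAddChar (q u + φ i y u - r * u) := by
    simp_rw [expect_mul]
    rw [expect_comm]
    refine expect_congr rfl fun i _ => ?_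
    simp_rw [quadAverage, expect_mul, mul_expect]
    rw [expect_comm, expect_comm (univ : Finset (ZMod N)) B]
    refine expect_congr rfl fun u _ => ?_
    refine Fintype.expect_equiv (Equiv.subRight u) _ _ fun x => ?_
    rw [Equiv.subRight_apply, ← stdAddChar_add, ← stdAddChar_add]
    congr 1
    ring
  obtain ⟨i, -, hi⟩ := exists_norm_expect_le univ_nonempty fun i => 𝔼 y,
    ZMod.stdAddChar (-(r * y)) * 𝔼 u ∈ B, ZMod.stdAddChar (q u + φ i y u - r * u)
  obtain ⟨y, -, hy⟩ := exists_norm_expect_le univ_nonempty fun y =>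
    ZMod.stdAddChar (-(r * y)) * 𝔼 u ∈ B, ZMod.stdAddChar (q u + φ i y u - r * u)
  refine ⟨i, y, r, hr.trans (pow_le_pow_left₀ (norm_nonneg _) ?_ 2)⟩
  rw [e]
  refine hi.trans (hy.trans_eq ?_)
  rw [norm_mul, norm_stdAddChar, one_mul]

theorem IsGenQuadraticAverage.exists_eq_expect {Q : ZMod N → ℂ}
    (hQ : IsGenQuadraticAverage B q Q) :
    ∃ n : ℕ, 0 < n ∧ ∃ φ : Fin n → ZMod N → ZMod N → ZMod N,
      (∀ i y, IsAddFreimanHom 2 (B : Set (ZMod N)) Set.univ (φ i y)) ∧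
      Q = fun x => 𝔼 i, quadAverage B q (φ i) x := by
  obtain ⟨n, hn, R, hR, hQ⟩ := hQ
  choose φ hφ hR using hR
  refine ⟨n, hn, φ, hφ, funext fun x => ?_⟩
  rw [hQ, Fintype.expect_eq_sum_div_card, Fintype.card_fin, inv_mul_eq_div]
  simp_rw [hR, expect_image_sub_eq_quadAverage]

theorem div_sqrt_mul_sqrt_card_le {d : ℕ} (hd : 1 ≤ d) {σ α : ℝ} (hσ : 0 < σ) (hσ2 : σ ≤ 2)
    (hσρ : σ ≤ ρ) (hα : 0 < α) (hα1 : α ≤ 1) (hK : #K ≤ d)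
    (hA : 3 / 2 * α * #(bohrSet K (ρ * (α ^ 2 / (40 * d)))) ≤ #A) :
    (N : ℝ) / (√(#A) * √(#(bohrSet K (ρ * (α ^ 2 / (40 * d))))))
      ≤ (4 / α) ^ (4 * d ^ 2) * (800 * (d : ℝ) ^ 2 / σ) ^ d := by
  have hd' : (1 : ℝ) ≤ d := by exact_mod_cast hd
  set κ : ℝ := α ^ 2 / (40 * d) with hκ
  have hκ0 : 0 < κ := by positivity
  have hκ1 : κ ≤ 1 := by
    rw [hκ, div_le_one (by positivity)]
    nlinarith
  set P := bohrSet K (ρ * κ) with hP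
  have hP0 : (0 : ℝ) < #P := by
    exact_mod_cast card_pos.2 ⟨0, zero_mem_bohrSet (mul_nonneg (hσ.le.trans hσρ) hκ0.le)⟩
  -- The density bound needs radius at most 2, which ρκ may exceed; it is therefore applied at the
  -- smaller radius σκ.
  have hσκ : σ * κ ≤ 2 := (mul_le_of_le_one_right hσ.le hκ1).trans hσ2
  have h1 : (N : ℝ) ≤ (9 / (σ * κ)) ^ d * #P := by
    have hle : (1 : ℝ) ≤ 9 / (σ * κ) := by
      rw [one_le_div (by positivity)]
      linarith
    refine (card_le_div_pow_mul_card_bohrSet K (by positivity) hσκ).trans ?_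
    refine mul_le_mul (pow_le_pow_right₀ hle hK) ?_ (by positivity) (by positivity)
    exact_mod_cast card_le_card (bohrSet_mono (mul_le_mul_of_nonneg_right hσρ hκ0.le))
  have h2 : α * #P ≤ √(#A) * √(#P) := by
    rw [← Real.sqrt_mul (Nat.cast_nonneg _)]
    refine Real.le_sqrt_of_sq_le ?_
    have : α * α * #P ≤ 3 / 2 * α * #P := by gcongr; linarith
    calc (α * #P) ^ 2 = α * α * #P * #P := by ring
      _ ≤ #A * #P := mul_le_mul_of_nonneg_right (this.trans hA) hP0.le
  have h3 : 9 / (σ * κ) ≤ (4 / α) ^ 2 * (800 * (d : ℝ) ^ 2 / σ) := by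
    rw [hκ]
    have : 9 / (σ * (α ^ 2 / (40 * d))) = 360 * d / (α ^ 2 * σ) := by
      field_simp
      norm_num
    rw [this, div_pow, div_mul_div_comm]
    exact div_le_div_of_nonneg_right (by nlinarith) (by positivity)
  have h4 : 1 ≤ 4 / α := by
    rw [one_le_div hα]
    linarith
  calc (N : ℝ) / (√(#A) * √(#P)) ≤ (9 / (σ * κ)) ^ d * #P / (α * #P) := by gcongr
    _ = 1 / α * (9 / (σ * κ)) ^ d := by field_simp
    _ ≤ 4 / α * ((4 / α) ^ 2 * (800 * (d : ℝ) ^ 2 / σ)) ^ d := by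
        gcongr
        norm_num
    _ = (4 / α) ^ (2 * d + 1) * (800 * (d : ℝ) ^ 2 / σ) ^ d := by
        rw [mul_pow, ← pow_mul, pow_succ]; ring
    -- Since d ≥ 1, 2d + 1 ≤ 4d².
    _ ≤ _ := by
        gcongr
        nlinarith

end Structure

end QuadraticAverage

/-! ### Choice of parameters and conclusion. -/

open QuadraticAverage in
theorem mainTheorem5 (N : ℕ) [NeZero N] (d : ℕ) (hd : 1 ≤ d) (ρ : ℝ) (hρ : 0 < ρ) (hρ2 : ρ ≤ 2)
    (Q : ZMod N → ℂ) (hQ : QuadraticAverage.IsGenQuadraticAverageOfComplexity d ρ Q)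
    (α : ℝ) (hα : 0 < α) (hα20 : α ≤ 1 / 20) :
    QuadraticAverage.u2Norm Q ≤ (12 * α) ^ (1 / 8 : ℝ) ∨
    ∃ Q'' : ZMod N → ℂ,
      ‖Q - Q''‖ ≤ 16 * (d : ℝ) ^ 2 * α ∧
      QuadraticAverage.u2DualNorm Q'' ≤
        ENNReal.ofReal ((4 / α) ^ (4 * d ^ 2) * (800 * (d : ℝ) ^ 2 / ρ) ^ d) := by
  rw [or_iff_not_imp_left, not_le]
  intro hbig
  obtain ⟨K, ρ', q, hK, hρρ', hreg, hq, hQ⟩ := hQ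
  obtain ⟨n, hn, φ, hφ, rfl⟩ := hQ.exists_eq_expect
  have hρ' : 0 ≤ ρ' := hρ.le.trans hρρ'
  have hd' : (1 : ℝ) ≤ d := by exact_mod_cast hd
  have hK' : (#K : ℝ) ≤ d := by exact_mod_cast hK
  obtain ⟨i, y, r, hr⟩ := exists_bias_of_expect_quadAverage (B := bohrSet K ρ') (q := q) hn (φ := φ)
  set b := ‖𝔼 u ∈ bohrSet K ρ', ZMod.stdAddChar (q u + φ i y u - r * u)‖ with hb
  have hb0 : 0 ≤ b := norm_nonneg _
  have hb1 : b ≤ 1 := norm_expect_le_of_forall_le zero_le_one fun u _ => (norm_stdAddChar _).le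
  have hb4 : 12 * α ≤ b ^ 4 := by
    have h1 := pow_le_pow_left₀ (by positivity) hbig.le 8
    rw [← Real.rpow_natCast, ← Real.rpow_mul (by positivity)] at h1
    norm_num at h1
    have h2 := pow_le_pow_left₀ (by positivity) hr 2
    rw [← pow_mul, ← pow_mul] at h2
    exact h1.trans h2
  have hb2 : b ^ 4 ≤ b ^ 2 := pow_le_pow_of_le_one hb0 hb1 (by norm_num)
  have hb3 : b ^ 2 ≤ b := pow_le_of_le_one hb0 hb1 (by norm_num)
  -- This scale gives 40|K|κ ≤ α², so every error C|K|κ is at most Cα²/40.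
  set κ : ℝ := α ^ 2 / (40 * d) with hκ
  have hκ0 : 0 < κ := by positivity
  have hKκ : 40 * (#K * κ) ≤ α ^ 2 := by
    calc 40 * (#K * κ) ≤ 40 * (d * κ) := by gcongr
      _ = α ^ 2 := by rw [hκ]; field_simp
  have hα2 : α ^ 2 ≤ α / 20 := by nlinarith
  have hκ1 : 2 * κ ≤ 1 := by
    have : κ ≤ d * κ := le_mul_of_one_le_left hκ0.le hd'
    have : 40 * (d * κ) = α ^ 2 := by rw [hκ]; field_simp
    linarith
  have hKκ1 : 100 * (#K : ℝ) * (2 * κ) ≤ 1 := by linarith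
  -- Half the bias absorbs the loss 200|K|κ ≤ 5α². With t = b/2 the density t²/2 = b²/8 is at least
  -- 3α/2.
  obtain ⟨a', ha', A, hA, hAcard, hmd⟩ := hreg.exists_mixedDiff_small hρ'
    (hq.add_freimanHom (hφ i y) r) hκ0 hκ1 hKκ1 (t := b / 2) (by positivity) (by linarith)
  have hP0 : (0 : ℝ) < #(bohrSet K (ρ' * κ)) := by
    exact_mod_cast card_pos.2 ⟨0, zero_mem_bohrSet (by positivity)⟩
  have hAcard' : 3 / 2 * α * #(bohrSet K (ρ' * κ)) ≤ #A := by
    refine le_trans ?_ hAcard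
    gcongr
    linarith
  have hA0 : A.Nonempty := by
    rw [← card_pos, ← Nat.cast_pos (α := ℝ)]
    exact lt_of_lt_of_le (by positivity) hAcard'
  have hmem : ∀ {v : ZMod N} {c : ℝ}, c ≤ 1 → v ∈ bohrSet K (ρ' * c) → v ∈ bohrSet K ρ' :=
    fun hc hv => bohrSet_mono (mul_le_of_le_one_right hρ' hc) hv
  have hadd : ∀ {v w : ZMod N}, v ∈ bohrSet K (ρ' * κ) → w ∈ bohrSet K (ρ' * κ) →
      v + w ∈ bohrSet K ρ' := fun hv hw => by
    refine hmem hκ1 ?_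
    rw [show ρ' * (2 * κ) = ρ' * κ + ρ' * κ by ring]
    exact add_mem_bohrSet hv hw
  -- The bound is 600|K|κ ≤ 15α² divided by 3α/2.
  have hmd' : ∀ a ∈ A, ∀ p ∈ bohrSet K (ρ' * κ),
      ‖ZMod.stdAddChar (mixedDiff q a a' p) - 1‖ ≤ 10 * α := by
    intro a ha p hp
    have h := hmd a ha p hp
    rw [mixedDiff_add_freimanHom (hφ i y) r (hmem (by linarith) (hA ha)) (hmem (by linarith) ha')
      (hadd (hA ha) hp) (hadd ha' hp)] at h
    set c := ‖ZMod.stdAddChar (mixedDiff q a a' p) - 1‖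
    have h1 : c * (3 / 2 * α) ≤ c * ((b / 2) ^ 2 / 2) := by
      gcongr
      linarith
    refine le_of_mul_le_mul_right (h1.trans (h.trans ?_)) (by positivity : 0 < 3 / 2 * α)
    linarith
  refine ⟨fun x => 𝔼 i, structuredAverage (bohrSet K ρ') A (bohrSet K (ρ' * κ)) a' q (φ i) x,
    ?_, ?_⟩
  · rw [pi_norm_le_iff_of_nonneg (by positivity)]
    intro x
    rw [Pi.sub_apply, ← expect_sub_distrib]
    refine norm_expect_le_of_forall_le (by positivity) fun j _ => ?_
    refine (hreg.norm_quadAverage_sub_structuredAverage_le hρ' hq (hφ j) hκ0 hκ1 hKκ1 ha' hA hA0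
      (by positivity) hmd' x).trans ?_
    -- The actual error is at most 10α + 20α² ≤ 11α.
    have : 16 * α ≤ 16 * (d : ℝ) ^ 2 * α := by
      gcongr
      nlinarith
    linarith
  · refine iSup₂_le fun h hh => ?_
    rw [← ofReal_norm]
    refine ENNReal.ofReal_le_ofReal ?_
    simp_rw [expect_mul]
    rw [expect_comm]
    refine norm_expect_le_of_forall_le (by positivity) fun j _ => ?_
    refine (norm_expect_structuredAverage_mul_conj_le hA0
      (card_pos.1 (by exact_mod_cast hP0)) a' h).trans ?_
    refine (mul_le_of_le_one_right (by positivity) hh).trans ?_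
    exact div_sqrt_mul_sqrt_card_le hd hρ hρ2 hρρ' hα (by linarith) hK hAcard'
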